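/- **Theorem 5.3 (High-dimensional consistency).** Fix an integer $k\ge 1$ and constants $K,B$. There is a constant $C_0>0$, depending only on $k,K,B$, such that the following holds for every $C\ge C_0$. For $n=1,2,\dots$ let $p=p_n$ be an arbitrary number of covariates, let $\mathcal X=\mathcal X_n\subset\mathbb R^{p}$, and let $x_1,\dots,x_n\in\mathcal X$ be fixed covariate vectors (which may depend on $n$) that are normalized in the sense that $\frac1n\sum_{i=1}^n x_{i,j}^2\le B$ for all $j=1,\dots,p$. For a parameter $\theta=(\phi_1,\dots,\phi_k,\rho_1,\dots,\rho_k,\pi_1,\dots,\pi_{k-1})$ with $\phi_r\in\mathbb R^p$, $\rho_r>0$, $\pi_r>0$, $\sum_{r=1}^{k-1}\pi_r<1$ and $\pi_k=1-\sum_{r=1}^{k-1}\pi_r$, let $$h_\theta(y\mid x)=\sum_{r=1}^k\pi_r\frac{\rho_r}{\sqrt{2\pi}}\exp\Big(-\tfrac12(\rho_r y-x^T\phi_r)^2\Big),\qquad \|\phi\|_1=\sum_{r=1}^k\|\phi_r\|_1 .$$ Let $\tilde\Theta=\tilde\Theta_n$ be any set of such parameters that satisfy $$\sup_{x\in\mathcal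 X}\max_{r\le k}|x^T\phi_r|\le K,\qquad \max_{r\le k}|\log\rho_r|\le K,\qquad -K\le\log\pi_r\le0\ \ (r=1,\dots,k-1),$$ let the true parameter $\theta_0=\theta_{0,n}$ belong to $\tilde\Theta$, and let $Y_1,\dots,Y_n$ be independent, where $Y_i$ has Lebesgue density $h_{\theta_0}(\cdot\mid x_i)$. Assume that $$\|\phi_0\|_1=o\Big(\sqrt{n/(\log^3 n\,\log(p\vee n))}\Big)\qquad(n\to\infty),$$ and put $\lambda=C\sqrt{\log^3 n\,\log(p\vee n)/n}$. Then any global minimizer $\hat\theta_\lambda$ of $$\theta\mapsto-\frac1n\sum_{i=1}^n\log h_\theta(Y_i\mid x_i)+\lambda\sum_{r=1}^k\|\phi_r\|_1\qquad\text{over }\theta\in\tilde\Theta$$ satisfies $\bar{\mathcal E}(\hat\theta_\lambda\mid\theta_0)=o_P(1)$ as $n\to\infty$, where $$\bar{\mathcal E}(\theta\mid\theta_0)=-\frac1n\sum_{i=1}^n\int\log\Big[\frac{h_\theta(y\mid x_i)}{h_{\theta_0}(y\mid x_i)}\Big]h_{\theta_0}(y\mid x_i)\,dy$$ is the average excess risk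 (average Kullback–Leibler loss). That is, for every $\varepsilon>0$, the (outer) probability that some global minimizer $\hat\theta_\lambda$ over $\tilde\Theta$ has $|\bar{\mathcal E}(\hat\theta_\lambda\mid\theta_0)|\ge\varepsilon$ tends to $0$. No restricted eigenvalue condition on the design is assumed. -/

import Mathlib

open Filter Topology MeasureTheory Asymptotics

noncomputable section

/-- Log-transformed parameters of a finite mixture of Gaussian regressions with `k = m + 1`
components and `p` covariates: the scaled regression vectors `φ_1, …, φ_k`, the logarithms of the
inverse standard deviations `ρ_1, …, ρ_k`, and the logarithms of the first `k - 1 = m` mixture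
weights. -/
@[ext]
structure FMRParam (m p : ℕ) where
  φ : Fin (m + 1) → Fin p → ℝ
  logρ : Fin (m + 1) → ℝ
  logπ : Fin m → ℝ

namespace FMRParam

variable {m p : ℕ}

/-- Inverse standard deviation of component `r`. -/
def ρ (θ : FMRParam m p) (r : Fin (m + 1)) : ℝ := Real.exp (θ.logρ r)

/-- Mixture weights; the last one is one minus the sum of the others. -/
def weight (θ : FMRParam m p) : Fin (m + 1) → ℝ :=
  Fin.snoc (α := fun _ => ℝ) (fun r => Real.exp (θ.logπ r)) (1 - ∑ r, Real.exp (θ.logπ r))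

/-- The conditional density `h_θ(y | x)` of the response at `y` given the covariate vector `x`. -/
def density (θ : FMRParam m p) (x : Fin p → ℝ) (y : ℝ) : ℝ :=
  ∑ r, θ.weight r * (θ.ρ r / √(2 * Real.pi)) *
    Real.exp (-(1 / 2) * (θ.ρ r * y - x ⬝ᵥ θ.φ r) ^ 2)

/-- `‖φ‖₁ = ∑ᵣ ‖φᵣ‖₁`. -/
def l1 (θ : FMRParam m p) : ℝ := ∑ r, ∑ j, |θ.φ r j|

/-- The bounded parameter set: `|xᵀφᵣ| ≤ K` for all `x` in the covariate space `𝒳`,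
`|log ρᵣ| ≤ K`, `-K ≤ log πᵣ ≤ 0` for `r ≤ k - 1`, and `π₁ + ⋯ + π_{k-1} < 1`. -/
def boundedSet (m : ℕ) {p : ℕ} (𝒳 : Set (Fin p → ℝ)) (K : ℝ) : Set (FMRParam m p) :=
  {θ | (∀ x ∈ 𝒳, ∀ r, |x ⬝ᵥ θ.φ r| ≤ K) ∧ (∀ r, |θ.logρ r| ≤ K) ∧
    (∀ r, -K ≤ θ.logπ r ∧ θ.logπ r ≤ 0) ∧ ∑ r, Real.exp (θ.logπ r) < 1}

/-- The excess risk (Kullback–Leibler information) of `θ` at the true parameter `θ₀`, given the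
covariate vector `x`: `-∫ log (h_θ(y|x) / h_{θ₀}(y|x)) h_{θ₀}(y|x) dy`. -/
def excessRisk (θ θ₀ : FMRParam m p) (x : Fin p → ℝ) : ℝ :=
  -∫ y : ℝ, Real.log (θ.density x y / θ₀.density x y) * θ₀.density x y

/-- The average excess risk over the design points `x₁, …, xₙ`. -/
def avgExcessRisk {n : ℕ} (x : Fin n → Fin p → ℝ) (θ θ₀ : FMRParam m p) : ℝ :=
  (1 / n : ℝ) * ∑ i, excessRisk θ θ₀ (x i)

/-- The `ℓ₁`-penalized negative log-likelihood, divided by `n`. -/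
def penNegLogLik {n : ℕ} (x : Fin n → Fin p → ℝ) (lam : ℝ) (Y : Fin n → ℝ)
    (θ : FMRParam m p) : ℝ :=
  -(1 / n : ℝ) * ∑ i, Real.log (θ.density (x i) (Y i)) + lam * θ.l1

/-- The joint law of the responses `(Y₁, …, Yₙ)` under `θ` at the fixed design `x₁, …, xₙ`:
the `Yᵢ` are independent and `Yᵢ` has Lebesgue density `h_θ(· | xᵢ)`. -/
def responseLaw {n : ℕ} (x : Fin n → Fin p → ℝ) (θ : FMRParam m p) : Measure (Fin n → ℝ) :=
  Measure.pi fun i => volume.withDensity fun y => ENNReal.ofReal (θ.density (x i) y)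

end FMRParam

/-- `log³ n · log (p ∨ n)`. -/
def logFactor (n p : ℕ) : ℝ := Real.log n ^ 3 * Real.log (max p n : ℕ)

end

/-!
The proof is a soft uniform law of large numbers: only `o(1)` is claimed, so truncation at a fixed
level and compactness replace all quantitative estimates on the log-density, and every `C > 0` works
(`C₀ = 1` is taken).

Let `ℓ_θ` be the log-density and `P_n`, `P` the empirical and the true mean. Comparing a minimizer
`θ` with `θ₀` gives the basic inequality `P_n ℓ_{θ₀} - P_n ℓ_θ ≤ λ ‖φ₀‖₁ - λ ‖φ‖₁`
(`sum_log_sub_le_of_isMinOn`). Hence the excess risk, which is nonnegative by Gibbs' inequality, is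
at most `λ ‖φ₀‖₁` plus the deviations `|(P_n - P) ℓ|` at `θ` and `θ₀`, and the sparsity assumption
says exactly that `λ ‖φ₀‖₁ → 0`. Three facts control the deviations.

* On the bounded parameter set, `|ℓ_θ(y)| ≤ L (1 + y²)` and the densities have a common Gaussian
  envelope (`abs_log_mixDensity_le`, `mixDensity_le_envelope`). By Markov's inequality the part of
  `ℓ_θ` outside `[-T, T]` is negligible for large fixed `T`. The same bound and the basic inequality
  show `λ ‖φ‖₁ ≤ A` for a constant `A` (`mul_l1_le_of_isMinOn`).
* The `ℓ₁`-ball of radius `R = A / λ` is covered by Maurey sparsification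
  (`exists_norm_sq_nsmul_sub_sum_le`): in the empirical `L²` norm of the design, `xᵀφ` is within
  squared distance `κ` of combinations of about `R² B / κ` columns, so
  `(2kp + 1) ^ (R² B / κ)` pieces suffice, times a constant number for the variances and weights.
  Truncated log-densities are uniformly continuous on a compact box, so they oscillate little on each
  piece (`exists_abs_truncLog_sub_le`).
* Since `R² log (p ∨ n) ≍ n / log³ n = o(n)`, the number of pieces is `exp (o(n))`
  (`tendsto_covering_mul_exp`), while Hoeffding's inequality bounds the deviation probability on
  each piece by `2 exp (-α n)` (`measure_uniform_deviation_le`). The union bound concludes.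
-/

/-! ### Gaussian mixture densities on a compact parameter box -/

namespace GaussianMixture

/-- What a parameter of a mixture of Gaussian regressions becomes at one design point `x`: the
linear predictors `xᵀφ_r`, the logarithms of the inverse standard deviations, and the logarithms of
all mixture weights but the last. -/
abbrev Param (m : ℕ) : Type := (Fin (m + 1) → ℝ) × (Fin (m + 1) → ℝ) × (Fin m → ℝ)

variable {m : ℕ}

/-- Mixture weights; the last one is one minus the sum of the others. -/
noncomputable def weight (w : Fin m → ℝ) : Fin (m + 1) → ℝ :=
  Fin.snoc (α := fun _ => ℝ) (fun r => Real.exp (w r)) (1 - ∑ r, Real.exp (w r))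

/-- Density of the component with linear predictor `u` and log inverse standard deviation `s`. -/
noncomputable def component (u s y : ℝ) : ℝ :=
  Real.exp s / √(2 * Real.pi) * Real.exp (-(1 / 2) * (Real.exp s * y - u) ^ 2)

/-- The mixture density. -/
noncomputable def mixDensity (q : Param m) (y : ℝ) : ℝ :=
  ∑ r, weight q.2.2 r * component (q.1 r) (q.2.1 r) y

/-- The compact parameter box. The last weight may vanish here, unlike in
`FMRParam.boundedSet`: closedness matters, positivity of the density survives. -/
def box (m : ℕ) (K : ℝ) : Set (Param m) :=
  {q | (∀ r, |q.1 r| ≤ K) ∧ (∀ r, |q.2.1 r| ≤ K) ∧ (∀ r, -K ≤ q.2.2 r ∧ q.2.2 r ≤ 0) ∧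
    ∑ r, Real.exp (q.2.2 r) ≤ 1}

lemma sum_weight (w : Fin m → ℝ) : ∑ r, weight w r = 1 := by
  simp [weight, Fin.sum_univ_castSucc]

lemma weight_nonneg {w : Fin m → ℝ} (hw : ∑ r, Real.exp (w r) ≤ 1) (r : Fin (m + 1)) :
    0 ≤ weight w r := by
  refine Fin.lastCases ?_ (fun i => ?_) r
  · simpa [weight] using hw
  · simpa [weight] using (Real.exp_pos _).le

lemma continuous_weight (r : Fin (m + 1)) : Continuous fun w : Fin m → ℝ => weight w r := by
  refine Fin.lastCases ?_ (fun i => ?_) r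
  · simp only [weight, Fin.snoc_last]; fun_prop
  · simp only [weight, Fin.snoc_castSucc]; fun_prop

lemma continuous_mixDensity : Continuous fun z : Param m × ℝ => mixDensity z.1 z.2 := by
  unfold mixDensity component
  refine continuous_finsetSum _ fun r _ => ?_
  refine ((continuous_weight r).comp (by fun_prop)).mul ?_
  fun_prop

lemma continuous_mixDensity_right (q : Param m) : Continuous (mixDensity q) := by
  unfold mixDensity component
  fun_prop

lemma component_eq_gaussianPDFReal (u s y : ℝ) :
    component u s y = ProbabilityTheory.gaussianPDFReal (u / Real.exp s)
      (Real.toNNReal (Real.exp s ^ 2)⁻¹) y := by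
  have h := Real.exp_pos s
  simp only [component, ProbabilityTheory.gaussianPDFReal,
    Real.coe_toNNReal _ (by positivity : 0 ≤ (Real.exp s ^ 2)⁻¹)]
  congr 1
  · rw [Real.sqrt_mul (x := 2 * Real.pi) (by positivity), Real.sqrt_inv, Real.sqrt_sq h.le]
    field_simp
  · congr 1
    field_simp

lemma integrable_component (u s : ℝ) : Integrable (component u s) := by
  rw [show component u s = _ from funext (component_eq_gaussianPDFReal u s)]
  exact ProbabilityTheory.integrable_gaussianPDFReal _ _

lemma integral_component (u s : ℝ) : ∫ y, component u s y = 1 := by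
  rw [show component u s = _ from funext (component_eq_gaussianPDFReal u s)]
  refine ProbabilityTheory.integral_gaussianPDFReal_eq_one _ (fun h => ?_)
  have h2 : 0 < (Real.exp s ^ 2)⁻¹ := by positivity
  exact (Real.toNNReal_eq_zero.1 h).not_gt h2

lemma component_pos (u s y : ℝ) : 0 < component u s y := by
  unfold component; positivity

lemma integrable_mixDensity (q : Param m) : Integrable (mixDensity q) := by
  unfold mixDensity
  exact integrable_finsetSum _ fun r _ => (integrable_component _ _).const_mul _

lemma integral_mixDensity (q : Param m) : ∫ y, mixDensity q y = 1 := by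
  unfold mixDensity
  rw [integral_finsetSum _ fun r _ => (integrable_component _ _).const_mul _]
  simp [integral_const_mul, integral_component, sum_weight]

variable {K : ℝ} {q : Param m}

lemma nonneg_of_mem_box (hq : q ∈ box m K) : 0 ≤ K := (abs_nonneg _).trans (hq.1 0)

lemma mixDensity_nonneg (hq : q ∈ box m K) (y : ℝ) : 0 ≤ mixDensity q y :=
  Finset.sum_nonneg fun r _ => mul_nonneg (weight_nonneg hq.2.2.2 r) (component_pos _ _ _).le

lemma exists_exp_neg_le_weight (hq : q ∈ box m K) : ∃ r, Real.exp (-K) ≤ weight q.2.2 r := by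
  have hK := nonneg_of_mem_box hq
  cases m with
  | zero => exact ⟨0, by rw [show weight q.2.2 0 = 1 by simpa using sum_weight q.2.2]; simpa⟩
  | succ m =>
    refine ⟨Fin.castSucc 0, ?_⟩
    simp only [weight, Fin.snoc_castSucc]
    exact Real.exp_le_exp.2 (hq.2.2.1 0).1

lemma le_mixDensity (hq : q ∈ box m K) (y : ℝ) :
    Real.exp (-(2 * K + Real.log √(2 * Real.pi) + K ^ 2 + Real.exp K ^ 2 * y ^ 2)) ≤
      mixDensity q y := by
  obtain ⟨r, hr⟩ := exists_exp_neg_le_weight hq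
  have hs := abs_le.1 (hq.2.1 r)
  have hu := abs_le.1 (hq.1 r)
  have hc : Real.exp (-K) / √(2 * Real.pi) * Real.exp (-(K ^ 2 + Real.exp K ^ 2 * y ^ 2)) ≤
      component (q.1 r) (q.2.1 r) y := by
    unfold component
    gcongr ?_ / _ * ?_
    · exact Real.exp_le_exp.2 hs.1
    · apply Real.exp_le_exp.2
      have h1 : Real.exp (q.2.1 r) ^ 2 * y ^ 2 ≤ Real.exp K ^ 2 * y ^ 2 := by
        gcongr; exact hs.2
      have h2 : q.1 r ^ 2 ≤ K ^ 2 := sq_le_sq' hu.1 hu.2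
      nlinarith [sq_nonneg (Real.exp (q.2.1 r) * y + q.1 r)]
  have hpi : 0 < √(2 * Real.pi) := by positivity
  calc _ = Real.exp (-K) *
        (Real.exp (-K) / √(2 * Real.pi) * Real.exp (-(K ^ 2 + Real.exp K ^ 2 * y ^ 2))) := by
        rw [div_eq_mul_inv, ← Real.exp_log (inv_pos.2 hpi), ← Real.exp_add, ← Real.exp_add,
          ← Real.exp_add, Real.log_inv]
        congr 1; ring
    _ ≤ weight q.2.2 r * component (q.1 r) (q.2.1 r) y := by
        gcongr; exact weight_nonneg hq.2.2.2 r
    _ ≤ _ := Finset.single_le_sum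
        (f := fun r => weight q.2.2 r * component (q.1 r) (q.2.1 r) y)
        (fun r _ => mul_nonneg (weight_nonneg hq.2.2.2 r) (component_pos _ _ _).le)
        (Finset.mem_univ r)

lemma mixDensity_pos (hq : q ∈ box m K) (y : ℝ) : 0 < mixDensity q y :=
  (Real.exp_pos _).trans_le (le_mixDensity hq y)

/-- A Gaussian envelope of all mixture densities with parameters in `box m K`. -/
noncomputable def envelope (K y : ℝ) : ℝ :=
  Real.exp K * Real.exp (K ^ 2 / 2) * Real.exp (-(Real.exp (-K) ^ 2 / 4) * y ^ 2)

lemma envelope_nonneg (K y : ℝ) : 0 ≤ envelope K y := by unfold envelope; positivity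

lemma mixDensity_le_of_component_le {b y : ℝ} (hq : q ∈ box m K)
    (h : ∀ r, component (q.1 r) (q.2.1 r) y ≤ b) : mixDensity q y ≤ b := by
  calc mixDensity q y ≤ ∑ r, weight q.2.2 r * b :=
        Finset.sum_le_sum fun r _ => mul_le_mul_of_nonneg_left (h r) (weight_nonneg hq.2.2.2 r)
    _ = b := by rw [← Finset.sum_mul, sum_weight, one_mul]

lemma one_le_sqrt_two_pi : 1 ≤ √(2 * Real.pi) := by
  rw [Real.one_le_sqrt]; linarith [Real.pi_gt_three]

lemma mixDensity_le_envelope (hq : q ∈ box m K) (y : ℝ) : mixDensity q y ≤ envelope K y := by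
  refine mixDensity_le_of_component_le hq fun r => ?_
  have hs := abs_le.1 (hq.2.1 r)
  have hu := abs_le.1 (hq.1 r)
  unfold component envelope
  rw [mul_assoc (Real.exp K), ← Real.exp_add]
  gcongr ?_ * ?_
  · calc _ ≤ Real.exp (q.2.1 r) := div_le_self (Real.exp_pos _).le one_le_sqrt_two_pi
      _ ≤ _ := Real.exp_le_exp.2 hs.2
  · apply Real.exp_le_exp.2
    have h1 : Real.exp (-K) ^ 2 * y ^ 2 ≤ Real.exp (q.2.1 r) ^ 2 * y ^ 2 := by
      gcongr; exact hs.1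
    have h2 : q.1 r ^ 2 ≤ K ^ 2 := sq_le_sq' hu.1 hu.2
    nlinarith [sq_nonneg (Real.exp (q.2.1 r) * y - 2 * q.1 r)]

lemma mixDensity_le_exp (hq : q ∈ box m K) (y : ℝ) : mixDensity q y ≤ Real.exp K := by
  refine mixDensity_le_of_component_le hq fun r => ?_
  unfold component
  calc _ ≤ Real.exp (q.2.1 r) / √(2 * Real.pi) * 1 := by
        gcongr
        exact Real.exp_le_one_iff.2 (by nlinarith [sq_nonneg (Real.exp (q.2.1 r) * y - q.1 r)])
    _ ≤ Real.exp (q.2.1 r) := by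
        rw [mul_one]; exact div_le_self (Real.exp_pos _).le one_le_sqrt_two_pi
    _ ≤ _ := Real.exp_le_exp.2 (abs_le.1 (hq.2.1 r)).2

/-- The constant in the quadratic bound for the log-density on `box m K`. -/
noncomputable def logConst (K : ℝ) : ℝ :=
  2 * |K| + Real.log √(2 * Real.pi) + K ^ 2 + Real.exp K ^ 2

lemma logConst_nonneg (K : ℝ) : 0 ≤ logConst K := by
  have := Real.log_nonneg one_le_sqrt_two_pi
  unfold logConst; positivity

lemma abs_log_mixDensity_le (hq : q ∈ box m K) (y : ℝ) :
    |Real.log (mixDensity q y)| ≤ logConst K * (1 + y ^ 2) := by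
  have hK := nonneg_of_mem_box hq
  have hl := Real.log_nonneg one_le_sqrt_two_pi
  have h1 := (Real.le_log_iff_exp_le (mixDensity_pos hq y)).2 (le_mixDensity hq y)
  have h2 := (Real.log_le_iff_le_exp (mixDensity_pos hq y)).2 (mixDensity_le_exp hq y)
  unfold logConst
  rw [abs_of_nonneg hK]
  have hy := sq_nonneg y
  have h3 : 0 ≤ (2 * K + Real.log √(2 * Real.pi) + K ^ 2) * y ^ 2 := by positivity
  have h4 : 0 ≤ Real.exp K ^ 2 := by positivity
  have h5 : 0 ≤ Real.exp K ^ 2 * y ^ 2 := by positivity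
  rw [abs_le]
  constructor <;> nlinarith

lemma measurable_log_mixDensity (q : Param m) : Measurable fun y => Real.log (mixDensity q y) :=
  Real.measurable_log.comp (continuous_mixDensity_right q).measurable

lemma integrable_sq_mul_envelope (K : ℝ) :
    Integrable fun y : ℝ => (1 + y ^ 2) * envelope K y := by
  have hb : 0 < Real.exp (-K) ^ 2 / 4 := by positivity
  have h0 := integrable_exp_neg_mul_sq hb
  have h2 := integrable_rpow_mul_exp_neg_mul_sq hb (s := 2) (by norm_num)
  refine ((h0.add h2).const_mul (Real.exp K * Real.exp (K ^ 2 / 2))).congr (ae_of_all _ fun y => ?_)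
  simp only [Pi.add_apply, envelope, Real.rpow_two]
  ring

/-- The tail weight `1 + y²` outside `[-T, T]`, which dominates the truncation error. -/
noncomputable def tail (T y : ℝ) : ℝ := if |y| ≤ T then 0 else 1 + y ^ 2

lemma tail_nonneg (T y : ℝ) : 0 ≤ tail T y := by unfold tail; split_ifs <;> positivity

lemma tail_le (T y : ℝ) : tail T y ≤ 1 + y ^ 2 := by
  unfold tail; split_ifs
  · positivity
  · exact le_rfl

lemma measurable_tail (T : ℝ) : Measurable (tail T) :=
  Measurable.ite (measurableSet_le (by fun_prop) (by fun_prop)) measurable_const (by fun_prop)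

lemma integrable_tail_mul_envelope (K T : ℝ) : Integrable fun y => tail T y * envelope K y := by
  refine (integrable_sq_mul_envelope K).mono'
    ((measurable_tail T).mul (by unfold envelope; fun_prop)).aestronglyMeasurable
    (ae_of_all _ fun y => ?_)
  rw [Real.norm_of_nonneg (mul_nonneg (tail_nonneg _ _) (envelope_nonneg _ _))]
  exact mul_le_mul_of_nonneg_right (tail_le _ _) (envelope_nonneg _ _)

lemma tendsto_integral_tail (K : ℝ) :
    Tendsto (fun T : ℝ => ∫ y, tail T y * envelope K y) atTop (𝓝 0) := by
  rw [← integral_zero ℝ ℝ (μ := volume)]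
  refine tendsto_integral_filter_of_dominated_convergence
    (fun y => (1 + y ^ 2) * envelope K y) ?_ ?_ (integrable_sq_mul_envelope K) ?_
  · exact Eventually.of_forall fun T => (integrable_tail_mul_envelope K T).aestronglyMeasurable
  · refine Eventually.of_forall fun T => ae_of_all _ fun y => ?_
    rw [Real.norm_of_nonneg (mul_nonneg (tail_nonneg _ _) (envelope_nonneg _ _))]
    exact mul_le_mul_of_nonneg_right (tail_le _ _) (envelope_nonneg _ _)
  · refine ae_of_all _ fun y => tendsto_const_nhds.congr' ?_
    filter_upwards [eventually_ge_atTop |y|] with T hT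
    simp [tail, hT]

lemma isCompact_box (m : ℕ) (K : ℝ) : IsCompact (box m K) := by
  refine IsCompact.of_isClosed_subset
    (isCompact_Icc (a := ((fun _ => -K, fun _ => -K, fun _ => -K) : Param m))
      (b := (fun _ => K, fun _ => K, fun _ => 0))) ?_ ?_
  · simp only [box, Set.ofPred_and, Set.ofPred_forall]
    refine IsClosed.inter ?_ (IsClosed.inter ?_ (IsClosed.inter ?_ ?_))
    · exact isClosed_iInter fun r => isClosed_le (by fun_prop) (by fun_prop)
    · exact isClosed_iInter fun r => isClosed_le (by fun_prop) (by fun_prop)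
    · exact isClosed_iInter fun r => (isClosed_le (by fun_prop) (by fun_prop)).inter
        (isClosed_le (by fun_prop) (by fun_prop))
    · exact isClosed_le (by fun_prop) (by fun_prop)
  · rintro ⟨u, s, w⟩ ⟨h1, h2, h3, -⟩
    exact ⟨⟨fun r => (abs_le.1 (h1 r)).1, fun r => (abs_le.1 (h2 r)).1, fun r => (h3 r).1⟩,
      ⟨fun r => (abs_le.1 (h1 r)).2, fun r => (abs_le.1 (h2 r)).2, fun r => (h3 r).2⟩⟩

/-- Compactness replaces every Lipschitz estimate: on `box m K × [-T, T]` the log-density is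
uniformly continuous. -/
lemma exists_dist_log_mixDensity_lt (m : ℕ) (K T : ℝ) {δ : ℝ} (hδ : 0 < δ) :
    ∃ τ : ℝ, 0 < τ ∧ ∀ q ∈ box m K, ∀ q' ∈ box m K, dist q q' < τ → ∀ y, |y| ≤ T →
      |Real.log (mixDensity q y) - Real.log (mixDensity q' y)| < δ := by
  have hc : IsCompact (box m K ×ˢ Set.Icc (-T) T) := (isCompact_box m K).prod isCompact_Icc
  have hcont : ContinuousOn (fun z : Param m × ℝ => Real.log (mixDensity z.1 z.2))
      (box m K ×ˢ Set.Icc (-T) T) :=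
    continuous_mixDensity.continuousOn.log fun z hz => (mixDensity_pos hz.1 z.2).ne'
  obtain ⟨τ, hτ, h⟩ := Metric.uniformContinuousOn_iff.1
    (hc.uniformContinuousOn_of_continuous hcont) δ hδ
  refine ⟨τ, hτ, fun q hq q' hq' hd y hy => ?_⟩
  have := h (q, y) ⟨hq, abs_le.1 hy⟩ (q', y) ⟨hq', abs_le.1 hy⟩
    (by simpa [Prod.dist_eq, hτ] using hd)
  simpa [Real.dist_eq] using this

/-- The law with density `mixDensity q`. -/
noncomputable def law (q : Param m) : Measure ℝ :=
  volume.withDensity fun y => ENNReal.ofReal (mixDensity q y)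

lemma isProbabilityMeasure_law (hq : q ∈ box m K) : IsProbabilityMeasure (law q) := by
  refine ⟨?_⟩
  rw [law, withDensity_apply _ MeasurableSet.univ, Measure.restrict_univ,
    ← ofReal_integral_eq_lintegral_ofReal (integrable_mixDensity q)
      (ae_of_all _ (mixDensity_nonneg hq)),
    integral_mixDensity, ENNReal.ofReal_one]

lemma integral_law (hq : q ∈ box m K) (f : ℝ → ℝ) :
    ∫ y, f y ∂law q = ∫ y, f y * mixDensity q y := by
  rw [law, integral_withDensity_eq_integral_toReal_smul
    (continuous_mixDensity_right q).measurable.ennreal_ofReal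
    (ae_of_all _ fun _ => ENNReal.ofReal_lt_top)]
  refine integral_congr_ae (ae_of_all _ fun y => ?_)
  simp [ENNReal.toReal_ofReal (mixDensity_nonneg hq y), mul_comm]

lemma integrable_law_iff (hq : q ∈ box m K) (f : ℝ → ℝ) :
    Integrable f (law q) ↔ Integrable fun y => f y * mixDensity q y := by
  rw [law, integrable_withDensity_iff (continuous_mixDensity_right q).measurable.ennreal_ofReal
    (ae_of_all _ fun _ => ENNReal.ofReal_lt_top)]
  simp [ENNReal.toReal_ofReal (mixDensity_nonneg hq _)]

lemma integrable_one_add_sq (hq : q ∈ box m K) : Integrable (fun y => 1 + y ^ 2) (law q) := by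
  rw [integrable_law_iff hq]
  refine (integrable_sq_mul_envelope K).mono'
    ((by fun_prop : Continuous fun y : ℝ => 1 + y ^ 2).mul
      (continuous_mixDensity_right q)).aestronglyMeasurable (ae_of_all _ fun y => ?_)
  rw [Real.norm_of_nonneg (mul_nonneg (by positivity) (mixDensity_nonneg hq y))]
  exact mul_le_mul_of_nonneg_left (mixDensity_le_envelope hq y) (by positivity)

lemma integrable_tail (hq : q ∈ box m K) (T : ℝ) : Integrable (tail T) (law q) :=
  (integrable_one_add_sq hq).mono' (measurable_tail T).aestronglyMeasurable
    (ae_of_all _ fun y => by rw [Real.norm_of_nonneg (tail_nonneg T y)]; exact tail_le T y)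

lemma integral_tail_le (hq : q ∈ box m K) (T : ℝ) :
    ∫ y, tail T y ∂law q ≤ ∫ y, tail T y * envelope K y := by
  rw [integral_law hq]
  exact integral_mono ((integrable_law_iff hq _).1 (integrable_tail hq T))
    (integrable_tail_mul_envelope K T) fun y =>
      mul_le_mul_of_nonneg_left (mixDensity_le_envelope hq y) (tail_nonneg _ _)

lemma integrable_log_mixDensity {q' : Param m} (hq : q ∈ box m K) (hq' : q' ∈ box m K) :
    Integrable (fun y => Real.log (mixDensity q' y)) (law q) :=
  ((integrable_one_add_sq hq).const_mul (logConst K)).mono'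
    (measurable_log_mixDensity q').aestronglyMeasurable
    (ae_of_all _ fun y => abs_log_mixDensity_le hq' y)

/-- Gibbs' inequality: Kullback–Leibler divergences are nonnegative. -/
lemma integral_log_mixDensity_le {q' : Param m} (hq : q ∈ box m K) (hq' : q' ∈ box m K) :
    ∫ y, Real.log (mixDensity q' y) ∂law q ≤ ∫ y, Real.log (mixDensity q y) ∂law q := by
  rw [← sub_nonpos,
    ← integral_sub (integrable_log_mixDensity hq hq') (integrable_log_mixDensity hq hq),
    integral_law hq]
  calc _ ≤ ∫ y, (mixDensity q' y - mixDensity q y) := by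
        refine integral_mono ((integrable_law_iff hq _).1
          ((integrable_log_mixDensity hq hq').sub (integrable_log_mixDensity hq hq)))
          ((integrable_mixDensity q').sub (integrable_mixDensity q)) fun y => ?_
        have h0 := mixDensity_pos hq y
        have h1 := mixDensity_pos hq' y
        have := Real.log_le_sub_one_of_pos (div_pos h1 h0)
        rw [Real.log_div h1.ne' h0.ne'] at this
        calc _ ≤ (mixDensity q' y / mixDensity q y - 1) * mixDensity q y :=
            mul_le_mul_of_nonneg_right this h0.le
          _ = _ := by field_simp
    _ = 0 := by rw [integral_sub (integrable_mixDensity q') (integrable_mixDensity q),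
          integral_mixDensity, integral_mixDensity,
          sub_self]

end GaussianMixture

/-! ### Sparsification of convex combinations -/

section Sparsification

variable {E : Type*} [NormedAddCommGroup E] [InnerProductSpace ℝ E]

/-- Maurey's lemma: a convex combination of vectors `Z i` with `‖Z i‖² ≤ b` is approximated by an
unweighted mean of `N` of them with squared error `b / N`. The points are chosen greedily: a
point of the convex hull never exceeds all the vertices in the direction of the current error. -/
lemma exists_norm_sq_nsmul_sub_sum_le {ι : Type*} [Fintype ι] (Z : ι → E) {b : ℝ}
    (hZ : ∀ i, ‖Z i‖ ^ 2 ≤ b) {c : ι → ℝ} (hc : ∀ i, 0 ≤ c i) (hc1 : ∑ i, c i = 1) (N : ℕ) :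
    ∃ σ : Fin N → ι, ‖(N : ℝ) • ∑ i, c i • Z i - ∑ l, Z (σ l)‖ ^ 2 ≤ N * b := by
  set v := ∑ i, c i • Z i with hv
  induction N with
  | zero => exact ⟨Fin.elim0, by simp⟩
  | succ N ih =>
    obtain ⟨σ, hσ⟩ := ih
    set D := (N : ℝ) • v - ∑ l, Z (σ l) with hD
    obtain ⟨i, hi⟩ : ∃ i, inner ℝ (D + v) v ≤ inner ℝ (D + v) (Z i) := by
      by_contra! h
      have h1 : inner ℝ (D + v) v = ∑ i, c i * inner ℝ (D + v) (Z i) := by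
        conv_lhs => rw [hv, inner_sum]
        simp only [inner_smul_right, ← hv]
      have h2 : ∑ i, c i * inner ℝ (D + v) (Z i) < ∑ i, c i * inner ℝ (D + v) v := by
        obtain ⟨j, hj⟩ : ∃ j, c j ≠ 0 := by
          by_contra! h0
          simp [h0] at hc1
        exact Finset.sum_lt_sum (fun i _ => mul_le_mul_of_nonneg_left (h i).le (hc i))
          ⟨j, Finset.mem_univ _, mul_lt_mul_of_pos_left (h j) ((hc j).lt_of_ne' hj)⟩
      rw [← Finset.sum_mul, hc1, one_mul, ← h1] at h2
      exact lt_irrefl _ h2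
    refine ⟨Fin.snoc (α := fun _ => ι) σ i, ?_⟩
    have e : ((N + 1 : ℕ) : ℝ) • v - ∑ l, Z (Fin.snoc (α := fun _ => ι) σ i l) =
        D + (v - Z i) := by
      simp only [Fin.sum_univ_castSucc, Fin.snoc_castSucc, Fin.snoc_last, hD]
      push_cast
      rw [add_smul, one_smul]
      abel
    rw [e, norm_add_sq_real, norm_sub_sq_real v, inner_sub_right]
    rw [inner_add_left, inner_add_left, real_inner_self_eq_norm_sq] at hi
    have := hZ i
    push_cast
    nlinarith [sq_nonneg ‖v‖]

/-- The vertices of the `ℓ₁`-ball image: `0` and `± X j`. -/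
def signedVertex {J : Type*} (X : J → E) : Option (J × Bool) → E
  | none => 0
  | some (j, true) => X j
  | some (j, false) => -X j

/-- The image of the `ℓ₁`-ball of radius `R` under `a ↦ ∑ j, a j • X j` splits into at most
`(2 |J| + 1) ^ ⌊R² b / κ⌋` pieces of squared diameter at most `8 κ`. Rounding down matters: when
`R² b < κ` no factor `2 |J| + 1` is lost, so `log |J|` may exceed the sample size. -/
lemma exists_sparse_code {J : Type*} [Fintype J] (X : J → E) {b R κ : ℝ}
    (hX : ∀ j, ‖X j‖ ^ 2 ≤ b) (hb : 0 ≤ b) (hR : 0 < R) (hκ : 0 < κ) :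
    ∃ code : (J → ℝ) → Fin ⌊R ^ 2 * b / κ⌋₊ → Option (J × Bool), ∀ a a',
      ∑ j, |a j| ≤ R → ∑ j, |a' j| ≤ R → code a = code a' →
        ‖∑ j, a j • X j - ∑ j, a' j • X j‖ ^ 2 ≤ 8 * κ := by
  set N := ⌊R ^ 2 * b / κ⌋₊ with hN
  have key : ∀ a : J → ℝ, ∃ σ : Fin N → Option (J × Bool), ∑ j, |a j| ≤ R →
      ‖(N : ℝ) • R⁻¹ • ∑ j, a j • X j - ∑ l, signedVertex X (σ l)‖ ^ 2 ≤ N * b := by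
    intro a
    by_cases ha : ∑ j, |a j| ≤ R
    · let c : Option (J × Bool) → ℝ := fun o => match o with
        | none => 1 - R⁻¹ * ∑ j, |a j|
        | some (j, true) => R⁻¹ * (a j)⁺
        | some (j, false) => R⁻¹ * (a j)⁻
      have hZ : ∀ o, ‖signedVertex X o‖ ^ 2 ≤ b := by
        rintro (_ | ⟨j, _ | _⟩) <;> simp [signedVertex, hb, hX]
      have hc : ∀ o, 0 ≤ c o := by
        rintro (_ | ⟨j, _ | _⟩)
        · simp only [c, sub_nonneg]
          rwa [inv_mul_le_iff₀ hR, mul_one]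
        · exact mul_nonneg (inv_nonneg.2 hR.le) (negPart_nonneg _)
        · exact mul_nonneg (inv_nonneg.2 hR.le) (posPart_nonneg _)
      have hc1 : ∑ o, c o = 1 := by
        rw [Fintype.sum_option, Fintype.sum_prod_type]
        simp only [c, Fintype.sum_bool, ← mul_add, posPart_add_negPart, ← Finset.mul_sum]
        ring
      have e : R⁻¹ • ∑ j, a j • X j = ∑ o, c o • signedVertex X o := by
        rw [Fintype.sum_option, Fintype.sum_prod_type, Finset.smul_sum]
        simp only [c, signedVertex, smul_zero, zero_add, Fintype.sum_bool]
        refine Finset.sum_congr rfl fun j _ => ?_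
        conv_lhs => rw [← posPart_sub_negPart (a j)]
        module
      obtain ⟨σ, hσ⟩ := exists_norm_sq_nsmul_sub_sum_le (signedVertex X) hZ hc hc1 N
      exact ⟨σ, fun _ => by rwa [e]⟩
    · exact ⟨fun _ => none, fun h => absurd h ha⟩
  choose code hcode using key
  refine ⟨code, fun a a' ha ha' h => ?_⟩
  set v := ∑ j, a j • X j
  set v' := ∑ j, a' j • X j
  have hbd : ∀ a : J → ℝ, ∑ j, |a j| ≤ R → ‖∑ j, a j • X j‖ ≤ R * √b := by
    intro a ha
    calc _ ≤ ∑ j, ‖a j • X j‖ := norm_sum_le _ _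
      _ ≤ ∑ j, |a j| * √b := Finset.sum_le_sum fun j _ => by
          rw [norm_smul, Real.norm_eq_abs]
          exact mul_le_mul_of_nonneg_left (Real.le_sqrt_of_sq_le (hX j)) (abs_nonneg _)
      _ ≤ R * √b := by rw [← Finset.sum_mul]; gcongr
  have hx0 : 0 ≤ R ^ 2 * b / κ := by positivity
  -- With `N = 0` there is a single piece, the whole image, which must then itself be small.
  rcases Nat.eq_zero_or_pos N with h0 | hpos
  · have h1 : R ^ 2 * b / κ < 1 := by rw [hN] at h0; exact Nat.floor_eq_zero.1 h0
    rw [div_lt_one hκ] at h1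
    have h2 : ‖v - v'‖ ≤ 2 * (R * √b) := by
      linarith [norm_sub_le v v', hbd a ha, hbd a' ha']
    have h3 : ‖v - v'‖ ^ 2 ≤ (2 * (R * √b)) ^ 2 := by gcongr
    have h4 : (2 * (R * √b)) ^ 2 = 4 * (R ^ 2 * b) := by
      rw [mul_pow, mul_pow, Real.sq_sqrt hb]; ring
    linarith
  · have h1 := hcode a ha
    have h2 := hcode a' ha'
    rw [h] at h1
    set S := ∑ l, signedVertex X (code a' l)
    have hN0 : (0 : ℝ) < N := by exact_mod_cast hpos
    have hN1 : (1 : ℝ) ≤ N := by exact_mod_cast hpos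
    have e : ((N : ℝ) * R⁻¹) • (v - v') =
        ((N : ℝ) • R⁻¹ • v - S) - ((N : ℝ) • R⁻¹ • v' - S) := by module
    have h3 : ‖((N : ℝ) * R⁻¹) • (v - v')‖ ^ 2 ≤ 4 * (N * b) := by
      rw [e]
      set p := (N : ℝ) • R⁻¹ • v - S
      set q := (N : ℝ) • R⁻¹ • v' - S
      have : ‖p - q‖ ^ 2 ≤ (‖p‖ + ‖q‖) ^ 2 := by gcongr; exact norm_sub_le p q
      nlinarith [sq_nonneg (‖p‖ - ‖q‖)]
    rw [norm_smul, mul_pow, Real.norm_of_nonneg (by positivity)] at h3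
    have h4 : R ^ 2 * b / κ < N + 1 := Nat.lt_floor_add_one _
    rw [div_lt_iff₀ hκ] at h4
    have h5 : (N : ℝ) ^ 2 * ‖v - v'‖ ^ 2 ≤ 4 * (N * b) * R ^ 2 := by
      have : (N : ℝ) ^ 2 * ‖v - v'‖ ^ 2 = ((N * R⁻¹) ^ 2 * ‖v - v'‖ ^ 2) * R ^ 2 := by
        field_simp
      rw [this]; gcongr
    have h6 : (N : ℝ) * ‖v - v'‖ ^ 2 ≤ 4 * (R ^ 2 * b) := by
      refine le_of_mul_le_mul_left ?_ hN0
      nlinarith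
    refine le_of_mul_le_mul_left ?_ hN0
    nlinarith

end Sparsification

/-! ### Deviation inequalities for independent coordinates -/

/-- Hoeffding's inequality for independent coordinates, two-sided. -/
lemma measure_pi_le_abs_sum_sub_integral {n : ℕ} (ν : Fin n → Measure ℝ)
    [∀ i, IsProbabilityMeasure (ν i)] {f : Fin n → ℝ → ℝ} (hf : ∀ i, Measurable (f i)) {M : ℝ}
    (hM : 0 ≤ M) (hfM : ∀ i y, |f i y| ≤ M) {t : ℝ} (ht : 0 ≤ t) :
    Measure.pi ν {Y | t ≤ |∑ i, (f i (Y i) - ∫ y, f i y ∂ν i)|} ≤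
      ENNReal.ofReal (2 * Real.exp (-t ^ 2 / (2 * (n * M ^ 2)))) := by
  set X : Fin n → (Fin n → ℝ) → ℝ := fun i Y => f i (Y i) - ∫ y, f i y ∂ν i with hXdef
  have hind : ProbabilityTheory.iIndepFun X (Measure.pi ν) :=
    ProbabilityTheory.iIndepFun_pi (X := fun i y => f i y - ∫ y, f i y ∂ν i)
      fun i => ((hf i).sub_const _).aemeasurable
  have hsub : ∀ i, ProbabilityTheory.HasSubgaussianMGF (X i) (Real.toNNReal (M ^ 2))
      (Measure.pi ν) := by
    intro i
    have h := ProbabilityTheory.hasSubgaussianMGF_of_mem_Icc (μ := Measure.pi ν) (a := -M) (b := M)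
      (X := fun Y => f i (Y i)) ((hf i).comp (measurable_pi_apply i)).aemeasurable
      (ae_of_all _ fun Y => abs_le.1 (hfM i _))
    have hint : ∫ Y, f i (Y i) ∂Measure.pi ν = ∫ y, f i y ∂ν i :=
      integral_comp_eval (hf i).aestronglyMeasurable
    rw [hint] at h
    convert h using 1
    ext
    rw [Real.coe_toNNReal _ (by positivity)]
    simp only [NNReal.coe_pow, NNReal.coe_div, coe_nnnorm, NNReal.coe_ofNat, sub_neg_eq_add,
      Real.norm_of_nonneg (by positivity : 0 ≤ M + M)]
    ring
  have hsum : ((∑ _i : Fin n, Real.toNNReal (M ^ 2) : NNReal) : ℝ) = n * M ^ 2 := by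
    simp [Real.coe_toNNReal _ (by positivity : 0 ≤ M ^ 2)]
  have h1 := ProbabilityTheory.HasSubgaussianMGF.measure_sum_ge_le_of_iIndepFun hind
    (s := Finset.univ) (fun i _ => hsub i) ht
  have h2 := ProbabilityTheory.HasSubgaussianMGF.measure_sum_ge_le_of_iIndepFun
    (X := fun i => -X i) (hind.comp (fun _ y => -y) fun _ => measurable_neg)
    (s := Finset.univ) (fun i _ => (hsub i).neg) ht
  rw [hsum] at h1 h2
  calc _ ≤ Measure.pi ν ({Y | t ≤ ∑ i, X i Y} ∪ {Y | t ≤ ∑ i, (-X i) Y}) := by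
        refine measure_mono fun Y hY => ?_
        simp only [Set.mem_union, Set.mem_ofPred_eq, Pi.neg_apply, Finset.sum_neg_distrib]
        exact le_abs.1 hY
    _ ≤ _ := measure_union_le _ _
    _ ≤ ENNReal.ofReal (Real.exp (-t ^ 2 / (2 * (n * M ^ 2)))) +
        ENNReal.ofReal (Real.exp (-t ^ 2 / (2 * (n * M ^ 2)))) := by
        gcongr
        · exact (ENNReal.le_ofReal_iff_toReal_le (measure_ne_top _ _) (Real.exp_pos _).le).2 h1
        · exact (ENNReal.le_ofReal_iff_toReal_le (measure_ne_top _ _) (Real.exp_pos _).le).2 h2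
    _ = _ := by rw [← ENNReal.ofReal_add (by positivity) (by positivity), ← two_mul]

/-- Union bound for a supremum over a family that a code with finitely many values splits into
pieces of small oscillation. The event on the left need not be measurable. -/
lemma measure_exists_le_card_mul {Ω ι κ : Type*} [MeasurableSpace Ω] [Fintype κ] (μ : Measure Ω)
    (F : Set ι) (code : ι → κ) (D : ι → Ω → ℝ) {t : ℝ} {c : ENNReal}
    (hosc : ∀ a ∈ F, ∀ b ∈ F, code a = code b → ∀ ω, |D a ω - D b ω| ≤ t)
    (hprob : ∀ a ∈ F, μ {ω | t ≤ |D a ω|} ≤ c) :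
    μ {ω | ∃ a ∈ F, 2 * t ≤ |D a ω|} ≤ Fintype.card κ * c := by
  classical
  let S : κ → Set Ω := fun k => {ω | ∃ a ∈ F, code a = k ∧ 2 * t ≤ |D a ω|}
  have hS : ∀ k, μ (S k) ≤ c := by
    intro k
    by_cases hk : ∃ a ∈ F, code a = k
    · obtain ⟨a, ha, rfl⟩ := hk
      refine (measure_mono ?_).trans (hprob a ha)
      rintro ω ⟨b, hb, hab, hω⟩
      have h1 := hosc b hb a ha hab ω
      have h2 := abs_sub_abs_le_abs_sub (D b ω) (D a ω)
      simp only [Set.mem_ofPred_eq]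
      linarith
    · have : S k = ∅ := by
        ext ω
        simp only [S, Set.mem_ofPred_eq, Set.mem_empty_iff_false, iff_false]
        rintro ⟨a, ha, h, -⟩
        exact hk ⟨a, ha, h⟩
      simp [this]
  calc _ ≤ μ (⋃ k, S k) := measure_mono (by
        rintro ω ⟨a, ha, h⟩
        exact Set.mem_iUnion.2 ⟨code a, a, ha, rfl, h⟩)
    _ ≤ ∑ k, μ (S k) := measure_iUnion_fintype_le _ _
    _ ≤ ∑ _k : κ, c := Finset.sum_le_sum fun k _ => hS k
    _ = _ := by simp

/-- Markov's inequality for a sum over independent coordinates. -/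
lemma measure_pi_le_sum {n : ℕ} (ν : Fin n → Measure ℝ) [∀ i, IsProbabilityMeasure (ν i)]
    (hn : 0 < n) {f : ℝ → ℝ} (hf : ∀ y, 0 ≤ f y) (hfi : ∀ i, Integrable f (ν i))
    {b t : ℝ} (ht : 0 < t)
    (hb : ∀ i, ∫ y, f y ∂ν i ≤ b) :
    Measure.pi ν {Y | t * n ≤ ∑ i, f (Y i)} ≤ ENNReal.ofReal (b / t) := by
  have hn' : (0 : ℝ) < n := by exact_mod_cast hn
  have hi : ∀ i, Integrable (fun Y : Fin n → ℝ => f (Y i)) (Measure.pi ν) := fun i =>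
    integrable_comp_eval (hfi i)
  have h1 := mul_meas_ge_le_integral_of_nonneg (μ := Measure.pi ν)
    (f := fun Y => ∑ i, f (Y i)) (ae_of_all _ fun Y => Finset.sum_nonneg fun i _ => hf _)
    (integrable_finsetSum _ fun i _ => hi i) (t * n)
  rw [integral_finsetSum _ fun i _ => hi i] at h1
  have h2 : ∑ i, ∫ Y, f (Y i) ∂Measure.pi ν ≤ n * b := by
    calc _ ≤ ∑ _i : Fin n, b := Finset.sum_le_sum fun i _ => by
          rw [integral_comp_eval (μ := ν) (hfi i).aestronglyMeasurable]; exact hb i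
      _ = _ := by simp
  have h3 : (Measure.pi ν).real {Y | t * n ≤ ∑ i, f (Y i)} ≤ b / t := by
    rw [le_div_iff₀ ht]
    refine le_of_mul_le_mul_left ?_ hn'
    linarith
  rw [← ENNReal.ofReal_toReal (measure_ne_top (Measure.pi ν) _)]
  exact ENNReal.ofReal_le_ofReal h3

/-! ### Truncated log-densities -/

namespace GaussianMixture

variable {m : ℕ} {K : ℝ}

/-- The log-density cut off outside `[-T, T]`. -/
noncomputable def truncLog (T : ℝ) (q : Param m) (y : ℝ) : ℝ :=
  if |y| ≤ T then Real.log (mixDensity q y) else 0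

lemma measurable_truncLog (T : ℝ) (q : Param m) : Measurable (truncLog T q) :=
  Measurable.ite (measurableSet_le (by fun_prop) (by fun_prop)) (measurable_log_mixDensity q)
    measurable_const

lemma abs_truncLog_le {q : Param m} (hq : q ∈ box m K) (T y : ℝ) :
    |truncLog T q y| ≤ logConst K * (1 + T ^ 2) := by
  have hc := logConst_nonneg K
  unfold truncLog
  split_ifs with h
  · refine (abs_log_mixDensity_le hq y).trans ?_
    gcongr logConst K * (1 + ?_)
    exact sq_le_sq' (abs_le.1 h).1 (abs_le.1 h).2
  · rw [abs_zero]; positivity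

lemma abs_log_mixDensity_sub_truncLog_le {q : Param m} (hq : q ∈ box m K) (T y : ℝ) :
    |Real.log (mixDensity q y) - truncLog T q y| ≤ logConst K * tail T y := by
  unfold truncLog tail
  split_ifs
  · simp
  · simpa using abs_log_mixDensity_le hq y

/-- Oscillation of the truncated log-density: small when the linear predictors are close, and in
any case controlled by their squared distance. -/
lemma exists_abs_truncLog_sub_le (m : ℕ) (K T : ℝ) {δ : ℝ} (hδ : 0 < δ) :
    ∃ τ c : ℝ, 0 < τ ∧ 0 < c ∧ ∀ q ∈ box m K, ∀ q' ∈ box m K, dist q.2 q'.2 < τ → ∀ y,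
      |truncLog T q y - truncLog T q' y| ≤ δ + c * ∑ r, (q.1 r - q'.1 r) ^ 2 := by
  obtain ⟨τ, hτ, h⟩ := exists_dist_log_mixDensity_lt m K T hδ
  have hL := logConst_nonneg K
  set M := logConst K * (1 + T ^ 2) + 1 with hM
  have hM0 : 0 < M := by positivity
  refine ⟨τ, 2 * M / τ ^ 2, hτ, by positivity, fun q hq q' hq' hd y => ?_⟩
  have hS : 0 ≤ ∑ r, (q.1 r - q'.1 r) ^ 2 := Finset.sum_nonneg fun r _ => sq_nonneg _
  by_cases hy : |y| ≤ T
  · by_cases hd1 : dist q.1 q'.1 < τ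
    · have h1 := h q hq q' hq' (by rw [Prod.dist_eq]; exact max_lt hd1 hd) y hy
      simp only [truncLog, hy, if_true]
      have : 0 ≤ 2 * M / τ ^ 2 * ∑ r, (q.1 r - q'.1 r) ^ 2 := by positivity
      linarith
    -- Chebyshev: a linear predictor that is off by `τ` pays for the trivial bound `2 M`.
    · rw [dist_pi_lt_iff hτ] at hd1
      push Not at hd1
      obtain ⟨r, hr⟩ := hd1
      have h1 : τ ^ 2 ≤ ∑ r, (q.1 r - q'.1 r) ^ 2 := by
        calc τ ^ 2 ≤ (q.1 r - q'.1 r) ^ 2 := by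
              rw [Real.dist_eq] at hr
              rw [← sq_abs (q.1 r - q'.1 r)]
              gcongr
          _ ≤ _ := Finset.single_le_sum (f := fun r => (q.1 r - q'.1 r) ^ 2)
              (fun r _ => sq_nonneg _) (Finset.mem_univ r)
      have h2 : 2 * M ≤ 2 * M / τ ^ 2 * ∑ r, (q.1 r - q'.1 r) ^ 2 := by
        rw [div_mul_eq_mul_div, le_div_iff₀ (by positivity)]
        gcongr
      have h3 := abs_sub (truncLog T q y) (truncLog T q' y)
      have h4 := abs_truncLog_le hq T y
      have h5 := abs_truncLog_le hq' T y
      linarith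
  · simp only [truncLog, hy, if_false, sub_zero, abs_zero]
    positivity

end GaussianMixture

/-! ### Covering and the uniform law of large numbers -/

lemma exists_fin_code_of_isCompact {α : Type*} [PseudoMetricSpace α] {s : Set α} (hs : IsCompact s)
    {τ : ℝ} (hτ : 0 < τ) :
    ∃ (k : ℕ) (c : α → Fin k), ∀ a ∈ s, ∀ b ∈ s, c a = c b → dist a b < τ := by
  classical
  obtain ⟨t, -, htf, hcov⟩ := hs.finite_cover_balls (half_pos hτ)
  have := htf.fintype
  have h : ∀ a, ∃ o : Option t, a ∈ s → ∃ y, o = some y ∧ a ∈ Metric.ball (y : α) (τ / 2) := by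
    intro a
    by_cases ha : a ∈ s
    · obtain ⟨y, hy, hay⟩ := Set.mem_iUnion₂.1 (hcov ha)
      exact ⟨some ⟨y, hy⟩, fun _ => ⟨_, rfl, hay⟩⟩
    · exact ⟨none, fun h => absurd h ha⟩
  choose o ho using h
  refine ⟨_, fun a => Fintype.equivFin _ (o a), fun a ha b hb hab => ?_⟩
  obtain ⟨y, hy, hay⟩ := ho a ha
  obtain ⟨z, hz, hbz⟩ := ho b hb
  have hyz : y = z := by
    have := (Fintype.equivFin _).injective hab
    rw [hy, hz] at this
    exact Option.some_injective _ this
  subst hyz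
  rw [Metric.mem_ball] at hay hbz
  linarith [dist_triangle_right a b (y : α)]

namespace FMRParam

open GaussianMixture

variable {m p : ℕ}

/-- The parameters of the conditional law of the response at the covariate vector `x`. -/
def atPoint (x : Fin p → ℝ) (θ : FMRParam m p) : Param m := (fun r => x ⬝ᵥ θ.φ r, θ.logρ, θ.logπ)

lemma density_eq_mixDensity (x : Fin p → ℝ) (θ : FMRParam m p) :
    θ.density x = mixDensity (θ.atPoint x) := by
  ext y
  simp only [density, mixDensity, component, atPoint, ρ, mul_assoc]
  rfl

lemma atPoint_mem_box {𝒳 : Set (Fin p → ℝ)} {K : ℝ} {θ : FMRParam m p}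
    (hθ : θ ∈ boundedSet m 𝒳 K) {x : Fin p → ℝ} (hx : x ∈ 𝒳) : θ.atPoint x ∈ box m K :=
  ⟨hθ.1 x hx, hθ.2.1, hθ.2.2.1, hθ.2.2.2.le⟩

/-- Sparsification of the linear predictors in the empirical `L²` norm of the design. Only the
column normalization of the design enters. -/
lemma exists_code_predictors {n : ℕ} (x : Fin n → Fin p → ℝ) (hn : 0 < n) {B R κ : ℝ}
    (hB : 0 ≤ B) (hx : ∀ j, ∑ i, x i j ^ 2 ≤ B * n) (hR : 0 < R) (hκ : 0 < κ) :
    ∃ code : FMRParam m p → Fin ⌊R ^ 2 * B / κ⌋₊ → Option ((Fin (m + 1) × Fin p) × Bool),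
      ∀ θ θ' : FMRParam m p, θ.l1 ≤ R → θ'.l1 ≤ R → code θ = code θ' →
        ∑ i, ∑ r, (x i ⬝ᵥ θ.φ r - x i ⬝ᵥ θ'.φ r) ^ 2 ≤ 8 * (κ * n) := by
  have hn' : (0 : ℝ) < n := by exact_mod_cast hn
  let X : Fin (m + 1) × Fin p → EuclideanSpace ℝ (Fin n × Fin (m + 1)) := fun a =>
    WithLp.toLp 2 fun i => if i.2 = a.1 then x i.1 a.2 else 0
  have hX : ∀ a, ‖X a‖ ^ 2 ≤ B * n := by
    intro a
    rw [EuclideanSpace.norm_sq_eq, Fintype.sum_prod_type]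
    simpa [X, apply_ite] using hx a.2
  have hval : ∀ θ : FMRParam m p, ∀ i, (∑ a : Fin (m + 1) × Fin p, θ.φ a.1 a.2 • X a) i =
      x i.1 ⬝ᵥ θ.φ i.2 := by
    intro θ i
    rw [Fintype.sum_prod_type]
    simp [X, dotProduct, mul_comm, Finset.sum_comm (s := (Finset.univ : Finset (Fin (m + 1))))]
  have h := exists_sparse_code X hX (by positivity) hR (mul_pos hκ hn')
  rw [show R ^ 2 * (B * n) / (κ * n) = R ^ 2 * B / κ by field_simp] at h
  obtain ⟨code, hcode⟩ := h
  refine ⟨fun θ => code fun a => θ.φ a.1 a.2, fun θ θ' hθ hθ' hc => ?_⟩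
  have h := hcode _ _ (by rwa [Fintype.sum_prod_type]) (by rwa [Fintype.sum_prod_type]) hc
  rw [EuclideanSpace.norm_sq_eq, Fintype.sum_prod_type] at h
  simpa only [PiLp.sub_apply, hval, Real.norm_eq_abs, sq_abs] using h

/-- Uniform law of large numbers for the truncated log-densities over an `ℓ₁`-ball of radius `R`.
The constants `κ`, `α`, `k` do not depend on `n`, `p`, the design or `R`. -/
lemma measure_uniform_deviation_le (m : ℕ) (K T : ℝ) {t : ℝ} (ht : 0 < t) :
    ∃ (κ α : ℝ) (k : ℕ), 0 < κ ∧ 0 < α ∧ ∀ (n p : ℕ) (x : Fin n → Fin p → ℝ), 0 < n →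
      ∀ B R : ℝ, 0 ≤ B → (∀ j, ∑ i, x i j ^ 2 ≤ B * n) → 0 < R →
      ∀ F : Set (FMRParam m p), (∀ θ ∈ F, ∀ i, θ.atPoint (x i) ∈ box m K) →
      (∀ θ ∈ F, θ.l1 ≤ R) → ∀ q₀ : Fin n → Param m, (∀ i, q₀ i ∈ box m K) →
      Measure.pi (fun i => law (q₀ i)) {Y | ∃ θ ∈ F, 2 * (t * n) ≤
        |∑ i, (truncLog T (θ.atPoint (x i)) (Y i) -
          ∫ y, truncLog T (θ.atPoint (x i)) y ∂law (q₀ i))|} ≤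
      ENNReal.ofReal
        (k * (2 * ((m + 1) * p) + 1) ^ ⌊R ^ 2 * B / κ⌋₊ * (2 * Real.exp (-(α * n)))) := by
  obtain ⟨τ, c, hτ, hc, hosc⟩ := exists_abs_truncLog_sub_le m K T (δ := t / 4) (by positivity)
  obtain ⟨k, net, hnet⟩ := exists_fin_code_of_isCompact
    ((isCompact_box m K).image continuous_snd) hτ
  have hL := logConst_nonneg K
  set M := logConst K * (1 + T ^ 2) + 1 with hM
  have hM0 : 0 < M := by positivity
  refine ⟨t / (32 * c), t ^ 2 / (2 * M ^ 2), k, by positivity, by positivity, ?_⟩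
  intro n p x hn B R hB hx hR F hbox hl1 q₀ hq₀
  have hn' : (0 : ℝ) < n := by exact_mod_cast hn
  have hprob : ∀ i, IsProbabilityMeasure (law (q₀ i)) := fun i => isProbabilityMeasure_law (hq₀ i)
  obtain ⟨code, hcode⟩ := exists_code_predictors (m := m) x hn hB hx hR
    (κ := t / (32 * c)) (by positivity)
  have hmain := measure_exists_le_card_mul (Measure.pi fun i => law (q₀ i)) F
    (fun θ => (code θ, net (θ.logρ, θ.logπ)))
    (fun θ Y => ∑ i, (truncLog T (θ.atPoint (x i)) (Y i) -
          ∫ y, truncLog T (θ.atPoint (x i)) y ∂law (q₀ i)))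
    (t := t * n) (c := ENNReal.ofReal (2 * Real.exp (-(t ^ 2 / (2 * M ^ 2) * n)))) ?_ ?_
  · refine hmain.trans_eq ?_
    conv_rhs => rw [ENNReal.ofReal_mul (by positivity)]
    rw [Fintype.card_prod, Fintype.card_fun, Fintype.card_fin,
      Fintype.card_fin, Fintype.card_option, Fintype.card_prod, Fintype.card_prod,
      Fintype.card_fin, Fintype.card_fin, Fintype.card_bool, ← ENNReal.ofReal_natCast]
    congr 2
    push_cast
    ring
  · intro a ha b hb hab Y
    simp only [Prod.mk.injEq] at hab
    have hd := hcode a b (hl1 a ha) (hl1 b hb) hab.1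
    set w : Fin n → ℝ := fun i =>
      t / 4 + c * ∑ r, (x i ⬝ᵥ a.φ r - x i ⬝ᵥ b.φ r) ^ 2 with hw
    have hsum : ∑ i, w i ≤ t / 2 * n := by
      simp only [hw, Finset.sum_add_distrib, ← Finset.mul_sum, Finset.sum_const, Finset.card_univ,
        Fintype.card_fin, nsmul_eq_mul]
      calc _ ≤ n * (t / 4) + c * (8 * (t / (32 * c) * n)) := by gcongr
        _ = _ := by field_simp; ring
    have hpt : ∀ i y, |truncLog T (a.atPoint (x i)) y - truncLog T (b.atPoint (x i)) y| ≤ w i := by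
      intro i y
      refine hosc _ (hbox a ha i) _ (hbox b hb i) ?_ y
      exact hnet _ ⟨_, hbox a ha i, rfl⟩ _ ⟨_, hbox b hb i, rfl⟩ hab.2
    have hint : ∀ θ ∈ F, ∀ i, Integrable (truncLog T (θ.atPoint (x i))) (law (q₀ i)) :=
      fun θ hθ i => (integrable_const (logConst K * (1 + T ^ 2))).mono'
        (measurable_truncLog _ _).aestronglyMeasurable
        (ae_of_all _ fun y => abs_truncLog_le (hbox θ hθ i) T y)
    rw [← Finset.sum_sub_distrib]
    calc _ ≤ ∑ i, 2 * w i := (Finset.abs_sum_le_sum_abs _ _).trans (Finset.sum_le_sum fun i _ => by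
          have h1 := hpt i (Y i)
          have h2 : |∫ y, truncLog T (a.atPoint (x i)) y ∂law (q₀ i) -
              ∫ y, truncLog T (b.atPoint (x i)) y ∂law (q₀ i)| ≤ w i := by
            rw [← integral_sub (hint a ha i) (hint b hb i)]
            have hnorm : ∀ y, ‖truncLog T (a.atPoint (x i)) y -
                truncLog T (b.atPoint (x i)) y‖ ≤ w i := hpt i
            simpa using norm_integral_le_of_norm_le_const (μ := law (q₀ i)) (ae_of_all _ hnorm)
          rw [abs_le] at h1 h2 ⊢
          constructor <;> linarith)
      _ ≤ t * n := by rw [← Finset.mul_sum]; linarith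
  · intro a ha
    refine (measure_pi_le_abs_sum_sub_integral (fun i => law (q₀ i))
      (fun i => measurable_truncLog T (a.atPoint (x i))) hM0.le
      (fun i y => (abs_truncLog_le (hbox a ha i) T y).trans (by linarith))
      (by positivity : 0 ≤ t * n)).trans_eq ?_
    congr 3
    field_simp

end FMRParam

/-! ### Consequences of minimality -/

namespace FMRParam

open GaussianMixture

variable {m p n : ℕ}

lemma responseLaw_eq_pi (x : Fin n → Fin p → ℝ) (θ : FMRParam m p) :
    responseLaw x θ = Measure.pi fun i => law (θ.atPoint (x i)) := by
  simp only [responseLaw, law, density_eq_mixDensity]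

lemma excessRisk_eq {K : ℝ} {θ θ₀ : FMRParam m p} {x : Fin p → ℝ}
    (h : θ.atPoint x ∈ box m K) (h₀ : θ₀.atPoint x ∈ box m K) :
    excessRisk θ θ₀ x = ∫ y, Real.log (mixDensity (θ₀.atPoint x) y) ∂law (θ₀.atPoint x) -
      ∫ y, Real.log (mixDensity (θ.atPoint x) y) ∂law (θ₀.atPoint x) := by
  rw [← integral_sub (integrable_log_mixDensity h₀ h₀) (integrable_log_mixDensity h₀ h),
    integral_law h₀, excessRisk, ← integral_neg, density_eq_mixDensity, density_eq_mixDensity]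
  refine integral_congr_ae (ae_of_all _ fun y => ?_)
  simp only
  rw [Real.log_div (mixDensity_pos h y).ne' (mixDensity_pos h₀ y).ne']
  ring

lemma l1_nonneg (θ : FMRParam m p) : 0 ≤ θ.l1 :=
  Finset.sum_nonneg fun _ _ => Finset.sum_nonneg fun _ _ => abs_nonneg _

/-- The centered log-likelihood differs from its truncated version by at most the observed and the
expected tail. -/
lemma abs_sum_log_sub_integral_le {K T e : ℝ} (q q₀ : Fin n → Param m) (hq : ∀ i, q i ∈ box m K)
    (hq₀ : ∀ i, q₀ i ∈ box m K) (Y : Fin n → ℝ) (hY : ∑ i, tail T (Y i) ≤ e * n)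
    (hE : ∀ i, ∫ y, tail T y ∂law (q₀ i) ≤ e) :
    |∑ i, (Real.log (mixDensity (q i) (Y i)) - ∫ y, Real.log (mixDensity (q i) y) ∂law (q₀ i))| ≤
      |∑ i, (truncLog T (q i) (Y i) - ∫ y, truncLog T (q i) y ∂law (q₀ i))| +
        2 * (logConst K * e * n) := by
  have hL := logConst_nonneg K
  have hprob : ∀ i, IsProbabilityMeasure (law (q₀ i)) := fun i => isProbabilityMeasure_law (hq₀ i)
  have hint : ∀ i, Integrable (truncLog T (q i)) (law (q₀ i)) :=
    fun i => (integrable_const (logConst K * (1 + T ^ 2))).mono'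
      (measurable_truncLog _ _).aestronglyMeasurable
      (ae_of_all _ fun y => abs_truncLog_le (hq i) T y)
  have h1 : |∑ i, (Real.log (mixDensity (q i) (Y i)) - truncLog T (q i) (Y i))| ≤
      logConst K * (e * n) :=
    calc _ ≤ ∑ i, logConst K * tail T (Y i) := (Finset.abs_sum_le_sum_abs _ _).trans
          (Finset.sum_le_sum fun i _ => abs_log_mixDensity_sub_truncLog_le (hq i) T (Y i))
      _ ≤ _ := by rw [← Finset.mul_sum]; gcongr
  have h2 : |∑ i, (∫ y, Real.log (mixDensity (q i) y) ∂law (q₀ i) -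
      ∫ y, truncLog T (q i) y ∂law (q₀ i))| ≤ logConst K * (e * n) :=
    calc _ ≤ ∑ _i : Fin n, logConst K * e := (Finset.abs_sum_le_sum_abs _ _).trans
          (Finset.sum_le_sum fun i _ => by
            rw [← integral_sub (integrable_log_mixDensity (hq₀ i) (hq i)) (hint i)]
            have h : ‖∫ y, (Real.log (mixDensity (q i) y) - truncLog T (q i) y) ∂law (q₀ i)‖ ≤
                ∫ y, logConst K * tail T y ∂law (q₀ i) :=
              norm_integral_le_of_norm_le ((integrable_tail (hq₀ i) T).const_mul _)
                (ae_of_all _ (abs_log_mixDensity_sub_truncLog_le (hq i) T))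
            rw [integral_const_mul] at h
            exact h.trans (mul_le_mul_of_nonneg_left (hE i) hL))
      _ = _ := by simp; ring
  simp only [Finset.sum_sub_distrib] at h1 h2 ⊢
  have h3 := abs_le.1 h1
  have h4 := abs_le.1 h2
  have h5 := abs_le.1 (le_refl |∑ i, truncLog T (q i) (Y i) -
    ∑ i, ∫ y, truncLog T (q i) y ∂law (q₀ i)|)
  rw [abs_le]
  constructor <;> linarith

/-- The basic inequality `P_n ℓ_{θ₀} - P_n ℓ_θ ≤ λ ‖φ₀‖₁ - λ ‖φ‖₁` of penalized estimation. -/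
lemma sum_log_sub_le_of_isMinOn (hn : 0 < n) {x : Fin n → Fin p → ℝ} {lam : ℝ} {Y : Fin n → ℝ}
    {Θ : Set (FMRParam m p)} {θ θ₀ : FMRParam m p} (h : IsMinOn (penNegLogLik x lam Y) Θ θ)
    (h₀ : θ₀ ∈ Θ) :
    ∑ i, Real.log (mixDensity (θ₀.atPoint (x i)) (Y i)) -
      ∑ i, Real.log (mixDensity (θ.atPoint (x i)) (Y i)) ≤ n * (lam * θ₀.l1 - lam * θ.l1) := by
  have hn' : (0 : ℝ) < n := by exact_mod_cast hn
  have h1 : penNegLogLik x lam Y θ ≤ penNegLogLik x lam Y θ₀ := h h₀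
  simp only [penNegLogLik, density_eq_mixDensity] at h1
  have h2 := mul_le_mul_of_nonneg_left h1 hn'.le
  have e : ∀ S c : ℝ, n * (-(1 / n : ℝ) * S + c) = -S + n * c := by intro S c; field_simp
  rw [e, e] at h2
  linarith

/-- A priori bound on the penalty of a minimizer, from the quadratic growth of the log-density. -/
lemma mul_l1_le_of_isMinOn (hn : 0 < n) {K T e : ℝ} {x : Fin n → Fin p → ℝ} {lam : ℝ}
    {Y : Fin n → ℝ} {Θ : Set (FMRParam m p)} {θ θ₀ : FMRParam m p}
    (h : IsMinOn (penNegLogLik x lam Y) Θ θ) (h₀ : θ₀ ∈ Θ)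
    (hθ : ∀ i, θ.atPoint (x i) ∈ box m K) (hθ₀ : ∀ i, θ₀.atPoint (x i) ∈ box m K)
    (hY : ∑ i, tail T (Y i) ≤ e * n) :
    lam * θ.l1 ≤ lam * θ₀.l1 + 2 * (logConst K * (1 + T ^ 2 + e)) := by
  have hn' : (0 : ℝ) < n := by exact_mod_cast hn
  have hL := logConst_nonneg K
  have h1 := sum_log_sub_le_of_isMinOn hn h h₀
  have h2 : ∀ q : Fin n → Param m, (∀ i, q i ∈ box m K) →
      |∑ i, Real.log (mixDensity (q i) (Y i))| ≤ logConst K * (1 + T ^ 2 + e) * n := by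
    intro q hq
    calc _ ≤ ∑ i, logConst K * ((1 + T ^ 2) + tail T (Y i)) :=
          (Finset.abs_sum_le_sum_abs _ _).trans (Finset.sum_le_sum fun i _ => by
            refine (abs_log_mixDensity_le (hq i) (Y i)).trans ?_
            refine mul_le_mul_of_nonneg_left ?_ hL
            unfold tail
            split_ifs with hy
            · have := sq_le_sq' (abs_le.1 hy).1 (abs_le.1 hy).2
              linarith
            · nlinarith [sq_nonneg T])
      _ = logConst K * ((1 + T ^ 2) * n + ∑ i, tail T (Y i)) := by
          rw [← Finset.mul_sum, Finset.sum_add_distrib, Finset.sum_const, Finset.card_univ,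
            Fintype.card_fin, nsmul_eq_mul, mul_comm (n : ℝ)]
      _ ≤ logConst K * ((1 + T ^ 2) * n + e * n) := by gcongr
      _ = _ := by ring
  have h3 := abs_le.1 (h2 _ hθ)
  have h4 := abs_le.1 (h2 _ hθ₀)
  refine le_of_mul_le_mul_left ?_ hn'
  linarith

/-- On the event that the truncated log-likelihood deviates little, uniformly over the parameters
that the a priori bound allows, the excess risk of every minimizer is small. -/
lemma abs_avgExcessRisk_le_of_isMinOn (hn : 0 < n) {K T e d : ℝ} {x : Fin n → Fin p → ℝ} {lam : ℝ}
    {Y : Fin n → ℝ} {Θ : Set (FMRParam m p)} {θ θ₀ : FMRParam m p} (hlam : 0 ≤ lam)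
    (h : IsMinOn (penNegLogLik x lam Y) Θ θ) (h₀ : θ₀ ∈ Θ)
    (hθ : ∀ i, θ.atPoint (x i) ∈ box m K) (hθ₀ : ∀ i, θ₀.atPoint (x i) ∈ box m K)
    (hY : ∑ i, tail T (Y i) ≤ e * n)
    (hE : ∀ i, ∫ y, tail T y ∂law (θ₀.atPoint (x i)) ≤ e)
    (hdev : ∀ ϑ ∈ ({θ, θ₀} : Set (FMRParam m p)),
      |∑ i, (truncLog T (ϑ.atPoint (x i)) (Y i) -
        ∫ y, truncLog T (ϑ.atPoint (x i)) y ∂law (θ₀.atPoint (x i)))| ≤ d * n) :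
    |avgExcessRisk x θ θ₀| ≤ 2 * d + 4 * (logConst K * e) + lam * θ₀.l1 := by
  have hn' : (0 : ℝ) < n := by exact_mod_cast hn
  have h1 := sum_log_sub_le_of_isMinOn hn h h₀
  have h2 := (abs_sum_log_sub_integral_le (fun i => θ.atPoint (x i)) _ hθ hθ₀ Y hY hE).trans
    (add_le_add_left (hdev θ (by simp)) _)
  have h3 := (abs_sum_log_sub_integral_le (fun i => θ₀.atPoint (x i)) _ hθ₀ hθ₀ Y hY hE).trans
    (add_le_add_left (hdev θ₀ (by simp)) _)
  have hex : ∑ i, excessRisk θ θ₀ (x i) =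
      ∑ i, ∫ y, Real.log (mixDensity (θ₀.atPoint (x i)) y) ∂law (θ₀.atPoint (x i)) -
      ∑ i, ∫ y, Real.log (mixDensity (θ.atPoint (x i)) y) ∂law (θ₀.atPoint (x i)) := by
    rw [← Finset.sum_sub_distrib]
    exact Finset.sum_congr rfl fun i _ => excessRisk_eq (hθ i) (hθ₀ i)
  have hnonneg : 0 ≤ ∑ i, excessRisk θ θ₀ (x i) := Finset.sum_nonneg fun i _ => by
    rw [excessRisk_eq (hθ i) (hθ₀ i), sub_nonneg]
    exact integral_log_mixDensity_le (hθ₀ i) (hθ i)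
  rw [avgExcessRisk, abs_of_nonneg (by positivity), one_div, inv_mul_le_iff₀ hn', hex]
  rw [Finset.sum_sub_distrib] at h2 h3
  have h4 := abs_le.1 h2
  have h5 := abs_le.1 h3
  have h6 : 0 ≤ n * (lam * θ.l1) := mul_nonneg hn'.le (mul_nonneg hlam θ.l1_nonneg)
  nlinarith

end FMRParam

/-! ### Asymptotics and conclusion -/

lemma logFactor_pos {n : ℕ} (hn : 2 ≤ n) (p : ℕ) : 0 < logFactor n p := by
  have h1 : (1 : ℝ) < n := by exact_mod_cast hn
  have h2 : (1 : ℝ) < (max p n : ℕ) := by exact_mod_cast lt_max_of_lt_right hn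
  exact mul_pos (pow_pos (Real.log_pos h1) 3) (Real.log_pos h2)

/-- The covering number of an `ℓ₁`-ball of radius `A / λ` is `exp (o(n))`, since its logarithm is of
order `λ⁻² log (p ∨ n) ≍ n / log³ n`. It is beaten by the exponential deviation probability. -/
lemma tendsto_covering_mul_exp (m k : ℕ) {A B C κ α : ℝ} (hB : 0 ≤ B) (hC : 0 < C)
    (hκ : 0 < κ) (hα : 0 < α) (p : ℕ → ℕ) :
    Tendsto (fun n : ℕ => (k : ℝ) * (2 * ((m + 1) * p n) + 1) ^
      ⌊(A / (C * √(logFactor n (p n) / n))) ^ 2 * B / κ⌋₊ * (2 * Real.exp (-(α * n))))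
      atTop (𝓝 0) := by
  have hlim : Tendsto (fun n : ℕ => (k : ℝ) * (2 * Real.exp (-(α / 2 * n)))) atTop (𝓝 0) := by
    have h1 : Tendsto (fun n : ℕ => α / 2 * (n : ℝ)) atTop atTop :=
      tendsto_natCast_atTop_atTop.const_mul_atTop (by positivity)
    simpa using ((Real.tendsto_exp_neg_atTop_nhds_zero.comp h1).const_mul 2).const_mul (k : ℝ)
  have hlog : Tendsto (fun n : ℕ => Real.log n ^ 3) atTop atTop :=
    (tendsto_pow_atTop (by norm_num)).comp
      (Real.tendsto_log_atTop.comp tendsto_natCast_atTop_atTop)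
  refine squeeze_zero' (Eventually.of_forall fun n => by positivity) ?_ hlim
  filter_upwards [eventually_ge_atTop (2 * m + 3), eventually_ge_atTop 2,
    hlog.eventually_ge_atTop (4 * (A ^ 2 * B) / (C ^ 2 * κ * α))] with n hn1 hn2 hn3
  have hn' : (0 : ℝ) < n := by positivity
  have hLF := logFactor_pos hn2 (p n)
  set P : ℝ := ((max (p n) n : ℕ) : ℝ) with hP
  have hP1 : (1 : ℝ) < P := by
    rw [hP]; exact_mod_cast lt_max_of_lt_right hn2
  have hlP := Real.log_pos hP1
  have hln1 : 0 < Real.log n := Real.log_pos (by exact_mod_cast hn2)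
  have hln : 0 < Real.log n ^ 3 := pow_pos hln1 3
  have hbase : (2 * ((m + 1) * p n) + 1 : ℝ) ≤ P ^ 2 := by
    have h1 : (p n : ℝ) ≤ P := by rw [hP]; exact_mod_cast le_max_left _ _
    have h2 : (2 * m + 3 : ℝ) ≤ P := by
      rw [hP]; exact_mod_cast hn1.trans (le_max_right _ _)
    calc (2 * ((m + 1) * p n) + 1 : ℝ) ≤ 2 * ((m + 1) * P) + P := by gcongr
      _ = (2 * m + 3) * P := by ring
      _ ≤ P * P := by gcongr
      _ = P ^ 2 := by ring
  set N := ⌊(A / (C * √(logFactor n (p n) / n))) ^ 2 * B / κ⌋₊ with hN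
  have hNle : (N : ℝ) * (2 * Real.log P) ≤ α / 2 * n := by
    have h1 : (N : ℝ) ≤ (A / (C * √(logFactor n (p n) / n))) ^ 2 * B / κ :=
      Nat.floor_le (by positivity)
    have h2 : (A / (C * √(logFactor n (p n) / n))) ^ 2 * B / κ =
        A ^ 2 * B / (C ^ 2 * κ) * (n / (Real.log n ^ 3 * Real.log P)) := by
      rw [div_pow, mul_pow, Real.sq_sqrt (by positivity), logFactor, ← hP]
      field_simp
    rw [div_le_iff₀ (by positivity)] at hn3
    calc (N : ℝ) * (2 * Real.log P) ≤
          A ^ 2 * B / (C ^ 2 * κ) * (n / (Real.log n ^ 3 * Real.log P)) * (2 * Real.log P) := by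
          rw [← h2]; gcongr
      _ = (4 * (A ^ 2 * B)) * n / (2 * (C ^ 2 * κ * Real.log n ^ 3)) := by
          field_simp; norm_num
      _ ≤ (Real.log n ^ 3 * (C ^ 2 * κ * α)) * n / (2 * (C ^ 2 * κ * Real.log n ^ 3)) := by
          gcongr
      _ = α / 2 * n := by field_simp
  have hpow : (2 * ((m + 1) * p n) + 1 : ℝ) ^ N ≤ Real.exp (α / 2 * n) := by
    calc (2 * ((m + 1) * p n) + 1 : ℝ) ^ N ≤ (P ^ 2) ^ N := by gcongr
      _ = Real.exp (N * (2 * Real.log P)) := by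
          rw [← pow_mul, ← Real.exp_log (by positivity : 0 < P), ← Real.exp_nat_mul,
            Real.log_exp]
          push_cast; congr 1; ring
      _ ≤ _ := Real.exp_le_exp.2 hNle
  calc (k : ℝ) * (2 * ((m + 1) * p n) + 1) ^ N * (2 * Real.exp (-(α * n))) ≤
        k * Real.exp (α / 2 * n) * (2 * Real.exp (-(α * n))) := by gcongr
    _ = k * (2 * (Real.exp (α / 2 * n) * Real.exp (-(α * n)))) := by ring
    _ = k * (2 * Real.exp (-(α / 2 * n))) := by rw [← Real.exp_add]; congr 3; ring

/-- The sparsity assumption says that the penalty at the true parameter is negligible. -/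
lemma eventually_penalty_le {f : ℕ → ℝ} {p : ℕ → ℕ} (hf : ∀ n, 0 ≤ f n)
    (h : f =o[atTop] fun n => √((n : ℝ) / logFactor n (p n))) {C δ : ℝ} (hC : 0 < C)
    (hδ : 0 < δ) : ∀ᶠ n : ℕ in atTop, C * √(logFactor n (p n) / n) * f n ≤ δ := by
  filter_upwards [h.def (div_pos hδ hC), eventually_ge_atTop 2] with n hn hn2
  have hLF := logFactor_pos hn2 (p n)
  have hn' : (0 : ℝ) < n := by positivity
  rw [Real.norm_of_nonneg (hf n), Real.norm_of_nonneg (Real.sqrt_nonneg _)] at hn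
  calc C * √(logFactor n (p n) / n) * f n ≤
        C * √(logFactor n (p n) / n) * (δ / C * √(n / logFactor n (p n))) := by gcongr
    _ = δ * (√(logFactor n (p n) / n) * √(n / logFactor n (p n))) := by field_simp
    _ = δ := by
        rw [← Real.sqrt_mul (by positivity),
          show logFactor n (p n) / n * (n / logFactor n (p n)) = 1 by field_simp]
        simp

open GaussianMixture

theorem theorem5p3 (m : ℕ) (K B : ℝ) :
    ∃ C₀ : ℝ, 0 < C₀ ∧ ∀ C : ℝ, C₀ ≤ C →
      ∀ (p : ℕ → ℕ) (𝒳 : ∀ n, Set (Fin (p n) → ℝ)) (x : ∀ n, Fin n → Fin (p n) → ℝ)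
        (Θ : ∀ n, Set (FMRParam m (p n))) (θ₀ : ∀ n, FMRParam m (p n)),
        (∀ n i, x n i ∈ 𝒳 n) →
        (∀ n j, ∑ i, x n i j ^ 2 ≤ B * n) →
        (∀ n, Θ n ⊆ FMRParam.boundedSet m (𝒳 n) K) →
        (∀ n, θ₀ n ∈ Θ n) →
        ((fun n => (θ₀ n).l1) =o[atTop] fun n => √((n : ℝ) / logFactor n (p n))) →
        ∀ ε : ℝ, 0 < ε →
          Tendsto
            (fun n => FMRParam.responseLaw (x n) (θ₀ n)
              {Y | ∃ θ ∈ Θ n,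
                IsMinOn (FMRParam.penNegLogLik (x n) (C * √(logFactor n (p n) / (n : ℝ))) Y)
                  (Θ n) θ ∧
                ε ≤ |FMRParam.avgExcessRisk (x n) θ (θ₀ n)|})
            atTop (𝓝 0) := by
  -- The argument works for every positive `C`.
  refine ⟨1, one_pos, fun C hC p 𝒳 x Θ θ₀ hx𝒳 hxB hΘ hθ₀ hl1 ε hε => ?_⟩
  have hC0 : 0 < C := one_pos.trans_le hC
  have hbox : ∀ n, ∀ θ ∈ Θ n, ∀ i, θ.atPoint (x n i) ∈ box m K := fun n θ hθ i =>
    FMRParam.atPoint_mem_box (hΘ n hθ) (hx𝒳 n i)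
  have hL := logConst_nonneg K
  set L := logConst K with hLdef
  rw [ENNReal.tendsto_nhds_zero]
  intro η hη
  -- A finite `η` is needed to choose the truncation level.
  obtain ⟨η', hη', hη'η⟩ : ∃ η' : ℝ, 0 < η' ∧ ENNReal.ofReal η' ≤ η := by
    obtain ⟨r, hr0, hrη⟩ := ENNReal.lt_iff_exists_nnreal_btwn.1 hη
    exact ⟨r, by exact_mod_cast hr0, by simpa using hrη.le⟩
  -- The error budget: `ε / 8` for the deviations, `ε / 4` each for the tails and `λ ‖φ₀‖₁`.
  set e := ε / (16 * (L + 1)) with he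
  have he0 : 0 < e := by positivity
  have hLe : L * e ≤ ε / 16 := by
    rw [he, mul_div_assoc', div_le_div_iff₀ (by positivity) (by norm_num)]
    nlinarith
  obtain ⟨T, hTe, hTη⟩ : ∃ T : ℝ, (∫ y, tail T y * envelope K y) ≤ e ∧
      (∫ y, tail T y * envelope K y) ≤ η' / 2 * e := by
    have h := tendsto_integral_tail K
    obtain ⟨T, h1, h2⟩ := ((h.eventually_le_const he0).and
      (h.eventually_le_const (by positivity : 0 < η' / 2 * e))).exists
    exact ⟨T, h1, h2⟩
  set A := ε / 4 + 2 * (L * (1 + T ^ 2 + e)) with hA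
  have hA0 : 0 < A := by positivity
  obtain ⟨κ, α, k, hκ, hα, hdev⟩ :=
    FMRParam.measure_uniform_deviation_le m K T
    (by positivity : 0 < ε / 32)
  have hcov := tendsto_covering_mul_exp m k (A := A) (le_max_right B 0) hC0 hκ hα p
  filter_upwards [eventually_ge_atTop 2, hcov.eventually_le_const (half_pos hη'),
    eventually_penalty_le (fun n => (θ₀ n).l1_nonneg) hl1 hC0 (by positivity : 0 < ε / 4)]
    with n hn2 hcn hpen
  have hn : 0 < n := by omega
  have hn' : (0 : ℝ) < n := by exact_mod_cast hn
  have hLF := logFactor_pos hn2 (p n)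
  set lam := C * √(logFactor n (p n) / n) with hlam
  have hlam0 : 0 < lam := by positivity
  have hq₀ : ∀ i, (θ₀ n).atPoint (x n i) ∈ box m K := hbox n _ (hθ₀ n)
  have hprob : ∀ i, IsProbabilityMeasure (law ((θ₀ n).atPoint (x n i))) := fun i =>
    isProbabilityMeasure_law (hq₀ i)
  set F : Set (FMRParam m (p n)) := {θ | θ ∈ Θ n ∧ θ.l1 ≤ A / lam} with hF
  have hdevn := hdev n (p n) (x n) hn (max B 0) (A / lam) (le_max_right _ _)
    (fun j => (hxB n j).trans (by gcongr; exact le_max_left _ _)) (by positivity) F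
    (fun θ hθ => hbox n θ hθ.1) (fun θ hθ => hθ.2) _ hq₀
  have htailn := measure_pi_le_sum (fun i => law ((θ₀ n).atPoint (x n i))) hn (tail_nonneg T)
    (fun i => integrable_tail (hq₀ i) T) he0 (fun i => integral_tail_le (hq₀ i) T)
  rw [FMRParam.responseLaw_eq_pi]
  set μ := Measure.pi fun i => law ((θ₀ n).atPoint (x n i)) with hμ
  refine le_trans ?_ hη'η
  calc _ ≤ μ ({Y | ∃ θ ∈ F, 2 * (ε / 32 * n) ≤
          |∑ i, (truncLog T (θ.atPoint (x n i)) (Y i) -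
            ∫ y, truncLog T (θ.atPoint (x n i)) y ∂law ((θ₀ n).atPoint (x n i)))|} ∪
        {Y | e * n ≤ ∑ i, tail T (Y i)}) := by
        refine measure_mono ?_
        rintro Y ⟨θ, hθ, hmin, hrisk⟩
        by_contra hY
        simp only [Set.mem_union, Set.mem_ofPred_eq, not_or, not_exists, not_and, not_le] at hY
        obtain ⟨hY1, hY2⟩ := hY
        have hb := FMRParam.mul_l1_le_of_isMinOn hn hmin (hθ₀ n) (hbox n θ hθ) hq₀ hY2.le
        have hθF : θ ∈ F := ⟨hθ, by rw [le_div_iff₀ hlam0]; linarith⟩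
        have hθ₀F : θ₀ n ∈ F := ⟨hθ₀ n, by
          rw [le_div_iff₀ hlam0]
          have : 0 ≤ 2 * (L * (1 + T ^ 2 + e)) := by positivity
          linarith⟩
        have hfin := FMRParam.abs_avgExcessRisk_le_of_isMinOn hn (d := ε / 16) hlam0.le hmin
          (hθ₀ n) (hbox n θ hθ) hq₀ hY2.le (fun i => (integral_tail_le (hq₀ i) T).trans hTe) (by
            rintro ϑ (rfl | rfl)
            · linarith [hY1 _ hθF]
            · linarith [hY1 _ hθ₀F])
        linarith
    _ ≤ _ := measure_union_le _ _
    _ ≤ ENNReal.ofReal (η' / 2) + ENNReal.ofReal (η' / 2) := by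
        refine add_le_add (hdevn.trans (ENNReal.ofReal_le_ofReal hcn))
          (htailn.trans (ENNReal.ofReal_le_ofReal ?_))
        rwa [div_le_iff₀ he0]
    _ = ENNReal.ofReal η' := by
        rw [← ENNReal.ofReal_add (by positivity) (by positivity), add_halves]
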